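/- Let $G$ be a topological group that is amenable, i.e. every (jointly) continuous affine action of $G$ on a nonempty compact convex subset of a Hausdorff locally convex real topological vector space has a fixed point. Let $(V,\pi)$ be an isometric Banach $G$-module, i.e. $V$ is a real Banach space and $\pi$ is an action of $G$ on $V$ by linear isometries such that the map $G\times V\to V$, $(g,v)\mapsto \pi(g)v$, is continuous. Let $$V_G=\overline{\operatorname{span}}\{\,v-\pi(g)v : v\in V,\ g\in G\,\}.$$ Then the closed subspace $V_G$ is locally complemented in $V$: there is a constant $C\geqslant 1$ such that, for every finite-dimensional linear subspace $F\subseteq V$ and every $\epsilon>0$, there is a linear operator $T\colon F\to V_G$ with $\|T\|\leqslant C$ and $$\|v-Tv\|<\epsilon\|v\|\qquad\text{for all } v\in V_G\cap F,\ v\neq 0.$$ -/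

import Mathlib

universe u v

/-- A topological group `G` is amenable if every continuous affine action of `G` on a nonempty
compact convex subset `K` of a (real, Hausdorff) locally convex topological vector space has a
fixed point. The action is an action on `K` only, jointly continuous `G × K → K`, and affine in
the sense that it preserves convex combinations of points of `K`. -/
def IsAmenableTopologicalGroup (G : Type u) [Group G] [TopologicalSpace G] : Prop :=
  ∀ (E : Type u) [AddCommGroup E] [Module ℝ E] [TopologicalSpace E] [IsTopologicalAddGroup E]
    [ContinuousSMul ℝ E] [LocallyConvexSpace ℝ E] [T2Space E] (K : Set E),
    K.Nonempty → IsCompact K → Convex ℝ K →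
    ∀ [MulAction G K] [ContinuousSMul G K],
      (∀ (g : G) (x y z : K) (a b : ℝ), 0 ≤ a → 0 ≤ b → a + b = 1 →
        (z : E) = a • (x : E) + b • (y : E) →
          ((g • z : K) : E) = a • ((g • x : K) : E) + b • ((g • y : K) : E)) →
      ∃ x : K, ∀ g : G, g • x = x

/-- The subspace `V_G`: the closed linear span of the vectors `v - π(g) v`, for an action `π` of
`G` on `V` by linear isometries. -/
def coinvariantSubspace {G : Type u} [Group G] {V : Type v} [NormedAddCommGroup V]
    [NormedSpace ℝ V] (π : G →* (V ≃ₗᵢ[ℝ] V)) : Submodule ℝ V :=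
  (Submodule.span ℝ {w : V | ∃ (v : V) (g : G), w = v - π g v}).topologicalClosure

/-- A closed linear subspace `W` of `V` is locally complemented in `V` if there is a constant
`C ≥ 1` such that for every finite-dimensional subspace `F` of `V` and every `ε > 0` there is a
linear operator `T : F → W` with `‖T‖ ≤ C` and `‖v - T v‖ < ε ‖v‖` for all nonzero
`v ∈ W ∩ F`. -/
def IsLocallyComplemented {V : Type v} [NormedAddCommGroup V] [NormedSpace ℝ V]
    (W : Submodule ℝ V) : Prop :=
  IsClosed (W : Set V) ∧
    ∃ C : ℝ, 1 ≤ C ∧ ∀ F : Submodule ℝ V, FiniteDimensional ℝ F → ∀ ε : ℝ, 0 < ε →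
      ∃ T : F →L[ℝ] W, ‖T‖ ≤ C ∧
        ∀ v : F, (v : V) ∈ W → v ≠ 0 → ‖(v : V) - (T v : V)‖ < ε * ‖(v : V)‖

/-! A convex average `A` of the `π g` is a contraction and `v - A v` lies in `V_G`, so `1 - A` maps
into `V_G` with norm at most 2. It remains to make `A` small on the finite-dimensional space `V_G ∩
F`. If the averages of some `u` in the span stayed away from 0, Hahn–Banach would give a functional
bounded below by `c > 0` on the orbit of `u`; amenability excludes this
(`IsAmenableTopologicalGroup.not_forall_le_apply_sum`). Composing averages treats finitely many
vectors at once, in particular a basis. -/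

/-- The convex hull of the operators `π g`. -/
def averagingOperators {G : Type u} [Group G] {V : Type v} [NormedAddCommGroup V]
    [NormedSpace ℝ V] (π : G →* (V ≃ₗᵢ[ℝ] V)) : Set (V →L[ℝ] V) :=
  convexHull ℝ (Set.range fun g => ((π g).toContinuousLinearEquiv : V →L[ℝ] V))

section AveragingOperators

variable {G : Type u} [Group G] {V : Type v} [NormedAddCommGroup V] [NormedSpace ℝ V]
  {π : G →* (V ≃ₗᵢ[ℝ] V)}

theorem apply_mem_averagingOperators (g : G) :
    ((π g).toContinuousLinearEquiv : V →L[ℝ] V) ∈ averagingOperators π :=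
  subset_convexHull ℝ _ ⟨g, rfl⟩

theorem norm_apply_le_of_mem_averagingOperators {A : V →L[ℝ] V} (hA : A ∈ averagingOperators π)
    (v : V) : ‖A v‖ ≤ ‖v‖ := by
  have hc : Convex ℝ {A : V →L[ℝ] V | ‖A v‖ ≤ ‖v‖} := by
    intro A hA B hB a b ha hb hab
    simp only [Set.mem_ofPred_eq] at hA hB ⊢
    calc ‖(a • A + b • B) v‖ ≤ ‖a • A v‖ + ‖b • B v‖ := norm_add_le _ _
      _ = a * ‖A v‖ + b * ‖B v‖ := by
        rw [norm_smul, norm_smul, Real.norm_of_nonneg ha, Real.norm_of_nonneg hb]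
      _ ≤ a * ‖v‖ + b * ‖v‖ := by gcongr
      _ = ‖v‖ := by rw [← add_mul, hab, one_mul]
  refine convexHull_min ?_ hc hA
  rintro _ ⟨g, rfl⟩
  simp

theorem sub_apply_mem_coinvariantSubspace {A : V →L[ℝ] V} (hA : A ∈ averagingOperators π)
    (v : V) : v - A v ∈ coinvariantSubspace π := by
  have hc : Convex ℝ {A : V →L[ℝ] V | v - A v ∈ coinvariantSubspace π} := by
    intro A hA B hB a b ha hb hab
    have : v - (a • A + b • B) v = a • (v - A v) + b • (v - B v) := by
      have h1 : v = a • v + b • v := by rw [← add_smul, hab, one_smul]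
      simp only [add_apply, smul_apply, smul_sub]
      nth_rewrite 1 [h1]
      abel
    simp only [Set.mem_ofPred_eq] at hA hB ⊢
    rw [this]
    exact Submodule.add_mem _ (Submodule.smul_mem _ _ hA) (Submodule.smul_mem _ _ hB)
  refine convexHull_min ?_ hc hA
  rintro _ ⟨g, rfl⟩
  exact Submodule.le_topologicalClosure _ (Submodule.subset_span ⟨v, g, rfl⟩)

theorem apply_mem_coinvariantSubspace {A : V →L[ℝ] V} (hA : A ∈ averagingOperators π)
    {v : V} (hv : v ∈ coinvariantSubspace π) : A v ∈ coinvariantSubspace π := by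
  simpa using Submodule.sub_mem _ hv (sub_apply_mem_coinvariantSubspace hA v)

theorem comp_mem_averagingOperators {A B : V →L[ℝ] V} (hA : A ∈ averagingOperators π)
    (hB : B ∈ averagingOperators π) : A.comp B ∈ averagingOperators π := by
  have hS : Convex ℝ (averagingOperators π) := convex_convexHull ℝ _
  have hl : Convex ℝ {A : V →L[ℝ] V | A.comp B ∈ averagingOperators π} := by
    intro A hA A' hA' a b ha hb hab
    simp only [Set.mem_ofPred_eq, ContinuousLinearMap.add_comp, ContinuousLinearMap.smul_comp] at *
    exact hS hA hA' ha hb hab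
  refine convexHull_min ?_ hl hA
  rintro _ ⟨g, rfl⟩
  have hr : Convex ℝ {B : V →L[ℝ] V |
      ((π g).toContinuousLinearEquiv : V →L[ℝ] V).comp B ∈ averagingOperators π} := by
    intro B hB B' hB' a b ha hb hab
    simp only [Set.mem_ofPred_eq, ContinuousLinearMap.comp_add, ContinuousLinearMap.comp_smul] at *
    exact hS hB hB' ha hb hab
  refine convexHull_min ?_ hr hB
  rintro _ ⟨h, rfl⟩
  have : ((π g).toContinuousLinearEquiv : V →L[ℝ] V).comp
      ((π h).toContinuousLinearEquiv : V →L[ℝ] V) =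
      ((π (g * h)).toContinuousLinearEquiv : V →L[ℝ] V) := by
    ext v
    simp
  simp only [Set.mem_ofPred_eq]
  rw [this]
  exact apply_mem_averagingOperators _

end AveragingOperators

/-- A functional on an isometric Banach module of an amenable group cannot be bounded below by a
positive constant on the orbit of an element of the span of the vectors `w - π(k) w`. -/
theorem IsAmenableTopologicalGroup.not_forall_le_apply_sum {G : Type u} [Group G]
    [TopologicalSpace G] [IsTopologicalGroup G] (hG : IsAmenableTopologicalGroup G)
    {V : Type v} [NormedAddCommGroup V] [NormedSpace ℝ V]
    (π : G →* (V ≃ₗᵢ[ℝ] V)) (hπ : Continuous fun p : G × V => π p.1 p.2)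
    (φ : V →L[ℝ] ℝ) {c : ℝ} (hc : 0 < c) {n : ℕ} (w : Fin n → V) (k : Fin n → G) :
    ¬ ∀ g, c ≤ φ (π g (∑ i, (w i - π (k i) (w i)))) := by
  intro hφ
  -- Modelled on `f (i, g) = φ (π g (w i))`. Functions on `Fin n × G` stay in the universe of `G`,
  -- unlike the dual of `V`. The bounds give, in order, compactness, equicontinuity in `g`, and the
  -- lower bound to be contradicted. Left translation preserves all three: `π` is isometric, and `k
  -- i` acts on the right.
  let K : Set (Fin n × G → ℝ) := {f | (∀ p, |f p| ≤ ‖φ‖ * ‖w p.1‖) ∧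
    (∀ i g g', |f (i, g) - f (i, g')| ≤ ‖φ‖ * ‖π g (w i) - π g' (w i)‖) ∧
    ∀ g, c ≤ ∑ i, (f (i, g) - f (i, g * k i))}
  have hne : K.Nonempty := by
    refine ⟨fun p => φ (π p.2 (w p.1)), fun p => ?_, fun i g g' => ?_, fun g => ?_⟩
    · simpa using φ.le_opNorm (π p.2 (w p.1))
    · simpa using φ.le_opNorm (π g (w i) - π g' (w i))
    · simpa [map_sum, map_sub] using hφ g
  have hclosed : IsClosed K := by
    simp only [K, Set.ofPred_and, Set.ofPred_forall]
    refine IsClosed.inter ?_ (IsClosed.inter ?_ ?_)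
    · exact isClosed_iInter fun p => isClosed_le (by fun_prop) (by fun_prop)
    · exact isClosed_iInter fun i => isClosed_iInter fun g => isClosed_iInter fun g' =>
        isClosed_le (by fun_prop) (by fun_prop)
    · exact isClosed_iInter fun g => isClosed_le (by fun_prop) (by fun_prop)
  have hcompact : IsCompact K := by
    refine (isCompact_univ_pi fun p : Fin n × G =>
      isCompact_Icc (a := -(‖φ‖ * ‖w p.1‖)) (b := ‖φ‖ * ‖w p.1‖)).of_isClosed_subset hclosed ?_
    intro f hf p _
    exact abs_le.mp (hf.1 p)
  have habs : ∀ {a b x y M : ℝ}, 0 ≤ a → 0 ≤ b → a + b = 1 → |x| ≤ M → |y| ≤ M →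
      |a * x + b * y| ≤ M := fun {a b x y M} ha hb hab hx hy => by
    simpa [abs_le] using (convex_Icc (-M) M) (abs_le.mp hx) (abs_le.mp hy) ha hb hab
  have hconv : Convex ℝ K := by
    rintro f ⟨hf1, hf2, hf3⟩ f' ⟨hf1', hf2', hf3'⟩ a b ha hb hab
    refine ⟨fun p => ?_, fun i g g' => ?_, fun g => ?_⟩
    · exact habs ha hb hab (hf1 p) (hf1' p)
    · have := habs ha hb hab (hf2 i g g') (hf2' i g g')
      convert this using 2
      simp only [Pi.add_apply, Pi.smul_apply, smul_eq_mul]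
      ring
    · have h1 : ∑ i, ((a • f + b • f') (i, g) - (a • f + b • f') (i, g * k i)) =
          a * ∑ i, (f (i, g) - f (i, g * k i)) + b * ∑ i, (f' (i, g) - f' (i, g * k i)) := by
        rw [Finset.mul_sum, Finset.mul_sum, ← Finset.sum_add_distrib]
        refine Finset.sum_congr rfl fun i _ => ?_
        simp only [Pi.add_apply, Pi.smul_apply, smul_eq_mul]
        ring
      rw [h1]
      calc c = a * c + b * c := by rw [← add_mul, hab, one_mul]
        _ ≤ _ := by
          gcongr
          · exact hf3 g
          · exact hf3' g
  have hact : ∀ (h : G) (f : K),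
      (fun p : Fin n × G => (f : Fin n × G → ℝ) (p.1, h⁻¹ * p.2)) ∈ K := by
    rintro h ⟨f, hf1, hf2, hf3⟩
    refine ⟨fun p => hf1 (p.1, h⁻¹ * p.2), fun i g g' => ?_, fun g => ?_⟩
    · refine (hf2 i (h⁻¹ * g) (h⁻¹ * g')).trans_eq ?_
      simp only [map_mul, LinearIsometryEquiv.coe_mul, Function.comp_apply, ← map_sub,
        LinearIsometryEquiv.norm_map]
    · simpa only [mul_assoc] using hf3 (h⁻¹ * g)
  let : MulAction G K :=
    { smul := fun h f => ⟨_, hact h f⟩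
      one_smul := fun f => Subtype.ext <| funext fun p => by
        change (f : Fin n × G → ℝ) (p.1, 1⁻¹ * p.2) = _
        simp
      mul_smul := fun g h f => Subtype.ext <| funext fun p => by
        change (f : Fin n × G → ℝ) (p.1, (g * h)⁻¹ * p.2) =
          (f : Fin n × G → ℝ) (p.1, h⁻¹ * (g⁻¹ * p.2))
        simp [mul_assoc] }
  have smul_apply : ∀ (h : G) (f : K) (p : Fin n × G),
      ((h • f : K) : Fin n × G → ℝ) p = (f : Fin n × G → ℝ) (p.1, h⁻¹ * p.2) :=
    fun _ _ _ => rfl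
  have : ContinuousSMul G K := by
    refine ⟨Continuous.subtype_mk (continuous_pi fun p => ?_) _⟩
    change Continuous fun q : G × K => (q.2 : Fin n × G → ℝ) (p.1, q.1⁻¹ * p.2)
    rw [continuous_iff_continuousAt]
    rintro ⟨h, f⟩
    have hlim : Filter.Tendsto (fun q : G × K =>
        ‖φ‖ * ‖π (q.1⁻¹ * p.2) (w p.1) - π (h⁻¹ * p.2) (w p.1)‖ +
          |(q.2 : Fin n × G → ℝ) (p.1, h⁻¹ * p.2) - (f : Fin n × G → ℝ) (p.1, h⁻¹ * p.2)|)
        (nhds (h, f)) (nhds 0) := by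
      have hcont : Continuous fun q : G × K => π (q.1⁻¹ * p.2) (w p.1) :=
        hπ.comp (f := fun q : G × K => (q.1⁻¹ * p.2, w p.1)) (by fun_prop)
      have hcont' : Continuous fun q : G × K =>
        ‖φ‖ * ‖π (q.1⁻¹ * p.2) (w p.1) - π (h⁻¹ * p.2) (w p.1)‖ +
          |(q.2 : Fin n × G → ℝ) (p.1, h⁻¹ * p.2) - (f : Fin n × G → ℝ) (p.1, h⁻¹ * p.2)| := by
        have he : Continuous fun q : G × K => (q.2 : Fin n × G → ℝ) (p.1, h⁻¹ * p.2) :=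
          (continuous_apply _).comp (continuous_subtype_val.comp continuous_snd)
        fun_prop
      simpa using hcont'.tendsto (h, f)
    rw [ContinuousAt, tendsto_iff_dist_tendsto_zero]
    refine squeeze_zero (fun _ => dist_nonneg) (fun q => ?_) hlim
    rw [Real.dist_eq]
    -- Equicontinuity, uniform over `K`, controls the change of group element; pointwise convergence
    -- controls the change of function.
    refine (abs_sub_le _ ((q.2 : Fin n × G → ℝ) (p.1, h⁻¹ * p.2)) _).trans ?_
    gcongr
    exact q.2.2.2.1 _ _ _
  obtain ⟨f, hf⟩ := hG (Fin n × G → ℝ) K hne hcompact hconv (fun g x y z a b _ _ _ hz => by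
    funext p
    simp only [smul_apply, hz, Pi.add_apply, Pi.smul_apply])
  have hconst : ∀ i g, (f : Fin n × G → ℝ) (i, g) = (f : Fin n × G → ℝ) (i, 1) := fun i g => by
    rw [← congrArg (fun x : K => (x : Fin n × G → ℝ) (i, g)) (hf g)]
    simp [smul_apply]
  -- A fixed point is constant in `g`, so the sum vanishes and `c ≤ 0`.
  have hle := f.2.2.2 1
  simp only [hconst _ (1 * _), sub_self, Finset.sum_const_zero] at hle
  exact hc.not_ge hle

theorem exists_sum_sub_eq_of_mem_span {G : Type u} [Group G] {V : Type v} [NormedAddCommGroup V]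
    [NormedSpace ℝ V] {π : G →* (V ≃ₗᵢ[ℝ] V)} {u : V}
    (hu : u ∈ Submodule.span ℝ {w : V | ∃ (v : V) (g : G), w = v - π g v}) :
    ∃ (n : ℕ) (w : Fin n → V) (k : Fin n → G), u = ∑ i, (w i - π (k i) (w i)) := by
  obtain ⟨n, a, x, rfl⟩ := (Submodule.mem_span_set' (M := V)).mp hu
  choose w k hwk using fun i => (x i).2
  refine ⟨n, fun i => a i • w i, k, Finset.sum_congr rfl fun i _ => ?_⟩
  rw [hwk, smul_sub, map_smul]

section Amenable

variable {G : Type u} [Group G] [TopologicalSpace G] [IsTopologicalGroup G]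
  (hG : IsAmenableTopologicalGroup G) {V : Type v} [NormedAddCommGroup V] [NormedSpace ℝ V]
  {π : G →* (V ≃ₗᵢ[ℝ] V)} (hπ : Continuous fun p : G × V => π p.1 p.2)

include hG hπ

theorem exists_averagingOperator_norm_apply_lt {v : V} (hv : v ∈ coinvariantSubspace π)
    {ε : ℝ} (hε : 0 < ε) : ∃ A ∈ averagingOperators π, ‖A v‖ < ε := by
  obtain ⟨u, hu, hvu⟩ := Metric.mem_closure_iff.mp hv (ε / 2) (half_pos hε)
  suffices ∃ A ∈ averagingOperators π, ‖A u‖ < ε / 2 by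
    obtain ⟨A, hA, hAu⟩ := this
    refine ⟨A, hA, ?_⟩
    have h1 : A v = A (v - u) + A u := by simp
    have h2 := norm_apply_le_of_mem_averagingOperators hA (v - u)
    rw [dist_eq_norm] at hvu
    rw [h1]
    linarith [norm_add_le (A (v - u)) (A u)]
  by_contra! hcon
  have hconv : Convex ℝ ((fun A : V →L[ℝ] V => A u) '' averagingOperators π) :=
    (convex_convexHull ℝ _).is_linear_image ⟨fun _ _ => rfl, fun _ _ => rfl⟩
  have hdisj : Disjoint (Metric.ball (0 : V) (ε / 2))
      ((fun A : V →L[ℝ] V => A u) '' averagingOperators π) := by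
    rw [Set.disjoint_right]
    rintro _ ⟨A, hA, rfl⟩
    simpa using hcon A hA
  obtain ⟨φ, c, hφ, hφ'⟩ :=
    geometric_hahn_banach_open (convex_ball _ _) Metric.isOpen_ball hconv hdisj
  have hc : 0 < c := by simpa using hφ 0 (Metric.mem_ball_self (half_pos hε))
  obtain ⟨n, w, k, rfl⟩ := exists_sum_sub_eq_of_mem_span hu
  exact hG.not_forall_le_apply_sum π hπ φ hc w k fun g =>
    hφ' _ ⟨_, apply_mem_averagingOperators g, rfl⟩

theorem exists_averagingOperator_forall_norm_apply_lt (s : Finset V)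
    (hs : ∀ v ∈ s, v ∈ coinvariantSubspace π) {ε : ℝ} (hε : 0 < ε) :
    ∃ A ∈ averagingOperators π, ∀ v ∈ s, ‖A v‖ < ε := by
  classical
  induction s using Finset.induction_on with
  | empty => exact ⟨_, apply_mem_averagingOperators 1, by simp⟩
  | insert v s _ ih =>
    obtain ⟨A, hA, hAs⟩ := ih fun x hx => hs x (Finset.mem_insert_of_mem hx)
    -- `A v` is still in `V_G`, so a further average shrinks it; being a contraction, `B` keeps the
    -- earlier vectors small.
    obtain ⟨B, hB, hBv⟩ := exists_averagingOperator_norm_apply_lt hG hπ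
      (apply_mem_coinvariantSubspace hA (hs v (Finset.mem_insert_self v s))) hε
    refine ⟨B.comp A, comp_mem_averagingOperators hB hA, fun x hx => ?_⟩
    rcases Finset.mem_insert.mp hx with rfl | hx
    · exact hBv
    · exact (norm_apply_le_of_mem_averagingOperators hB _).trans_lt (hAs x hx)

theorem exists_averagingOperator_norm_apply_le_mul (F : Submodule ℝ V) [FiniteDimensional ℝ F]
    (hF : F ≤ coinvariantSubspace π) {ε : ℝ} (hε : 0 < ε) :
    ∃ A ∈ averagingOperators π, ∀ v ∈ F, ‖A v‖ ≤ ε * ‖v‖ := by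
  classical
  let b := Module.finBasis ℝ F
  obtain ⟨C, hC, hb⟩ := b.exists_opNorm_le (F := V)
  obtain ⟨A, hA, hAb⟩ := exists_averagingOperator_forall_norm_apply_lt hG hπ
    (Finset.univ.image fun i => (b i : V)) (by
      intro v hv
      obtain ⟨i, -, rfl⟩ := Finset.mem_image.mp hv
      exact hF (b i).2) (div_pos hε hC)
  refine ⟨A, hA, fun v hv => ?_⟩
  have hnorm : ‖A.comp F.subtypeL‖ ≤ C * (ε / C) := hb (div_pos hε hC).le fun i =>
    (hAb _ (Finset.mem_image_of_mem _ (Finset.mem_univ i))).le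
  rw [mul_div_cancel₀ _ hC.ne'] at hnorm
  exact (A.comp F.subtypeL).le_of_opNorm_le hnorm ⟨v, hv⟩

end Amenable

theorem mainTheorem11 {G : Type u} [Group G] [TopologicalSpace G] [IsTopologicalGroup G]
    (hG : IsAmenableTopologicalGroup G)
    {V : Type v} [NormedAddCommGroup V] [NormedSpace ℝ V] [CompleteSpace V]
    (π : G →* (V ≃ₗᵢ[ℝ] V)) (hπ : Continuous fun p : G × V => π p.1 p.2) :
    IsLocallyComplemented (coinvariantSubspace π) := by
  refine ⟨Submodule.isClosed_topologicalClosure _, 2, one_le_two, fun F hF ε hε => ?_⟩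
  -- Halving `ε` makes the final inequality strict.
  obtain ⟨A, hA, hAF⟩ := exists_averagingOperator_norm_apply_le_mul hG hπ
    (F ⊓ coinvariantSubspace π) inf_le_right (half_pos hε)
  refine ⟨((ContinuousLinearMap.id ℝ V - A).comp F.subtypeL).codRestrict _ fun v =>
    sub_apply_mem_coinvariantSubspace hA v, ?_, fun v hv hv0 => ?_⟩
  · refine ContinuousLinearMap.opNorm_le_bound _ zero_le_two fun v => ?_
    change ‖(v : V) - A v‖ ≤ 2 * ‖(v : V)‖
    linarith [norm_sub_le (v : V) (A v), norm_apply_le_of_mem_averagingOperators hA (v : V)]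
  · change ‖(v : V) - ((v : V) - A v)‖ < ε * ‖(v : V)‖
    have hpos : 0 < ‖(v : V)‖ := norm_pos_iff.mpr (by simpa using hv0)
    rw [sub_sub_cancel]
    exact (hAF v ⟨v.2, hv⟩).trans_lt (by gcongr; exact half_lt_self hε)
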